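/- Let $f(y,\theta)$ be a parametric family of densities with respect to a $\sigma$-finite measure $\nu$ on a measurable space $\mathcal Y$ (for instance Lebesgue measure on a measurable subset of a Euclidean space), with $\theta=(\beta,\gamma)\in\Theta\subset\mathbb R^{q_1}\times\mathbb R^{q_2}$, and let $y_1,y_2,\dots$ be independent random variables with density $f(\cdot,\theta_0)$, $\theta_0=(\beta_0,\gamma_0)\in\Theta$. $\mathrm E$ and "integrable" (when no measure is named) refer to the density $f(\cdot,\theta_0)$. For sub-models $m=1,\dots,M$, given by sets $S_m\subseteq\{1,\dots,q_2\}$, the parameter is $\theta_{S_m}=(\beta,\gamma_{S_m})\in\mathbb R^{k_m}$, $k_m=q_1+|S_m|$, and $\theta_m\in\mathbb R^{q_1+q_2}$ denotes the corresponding full vector with $\gamma_j=0$ for $j\notin S_m$. The sub-model $m_o$ is true, i.e. $\gamma_{0,j}=0$ for $j\notin S_{m_o}$; sub-model $m$ is underfitted if $S_{m_o}\not\subseteq S_m$. Let $m$ be underfitted, let $\Theta_m\subseteq\mathbb R^{k_m}$ be a set of parameters $\theta_{S_m}$ with $\theta_m\in\Theta$, and let $\Theta(m)$ be the set of all $\theta_{S_m}\in\mathbb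 R^{k_m}$ with $\theta_m\in\Theta$. Assume: 1. $\Theta$ is compact, $f(y,\theta)$ is measurable in $y$ for every $\theta\in\Theta$ and continuous in $\theta\in\Theta$ for every $y$, and $\theta_0$ is identifiable: if $\theta\in\Theta$ and $f(\cdot,\theta)=f(\cdot,\theta_0)$ $\nu$-almost everywhere, then $\theta=\theta_0$. 2. (a) $\mathrm E\log f(y,\theta_m)$ exists and $|\log f(y,\theta_m)|\le K_m(y)$ (with $\log 0=-\infty$, so that $f(y,\theta_m)>0$) for all $y$ and all $\theta_{S_m}\in\Theta(m)$, where $K_m$ is real-valued and integrable; moreover $\log\{f(y,\theta_0)/f(y,\theta_m)\}$ is integrable, so that $I(\theta_m)=\mathrm E\left[\log\{f(y,\theta_0)/f(y,\theta_m)\}\right]$ is well defined. (b) Over $\theta_{S_m}\in\Theta_m$, $I(\theta_m)$ has a unique minimiser $\theta^*_{S_m}\in\Theta_m$; its full version is $\theta^*_m$. 3. For $\theta_{S_m}$ in the interior of $\Theta(m)$ the second partial derivatives of $f(y,\theta_m)$ with respect to $\theta_{S_m}$ exist and are continuous for all $y$, and they are $\nu$-integrable and may be passed under the integral sign in $\int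 f(y,\theta_m)\,d\nu(y)$. 4. For all $i,j$, $\left|\partial^2\log f(y,\theta_m)/\partial\theta_i\partial\theta_j\right|$ and $\left|\partial\log f(y,\theta_m)/\partial\theta_i\cdot\partial\log f(y,\theta_m)/\partial\theta_j\right|$ (derivatives in the coordinates of $\theta_{S_m}$) are dominated, for all $y$ and all $\theta_{S_m}$ in the interior of $\Theta(m)$, by integrable functions of $y$. 5. (a) $\theta^*_{S_m}$ is interior to $\Theta_m$; (b) the matrix $\mathrm E\left[\frac{\partial\log f(y,\theta_m)}{\partial\theta_{S_m}}\frac{\partial\log f(y,\theta_m)}{\partial\theta_{S_m}^{T}}\right]$ is nonsingular at $\theta^*_{S_m}$; (c) the matrix $A_m(\theta_{S_m})=\mathrm E\left[\frac{\partial^2\log f(y,\theta_m)}{\partial\theta_{S_m}\partial\theta_{S_m}^{T}}\right]$ has constant rank in some open neighbourhood of $\theta^*_{S_m}$. Let $l_n(\theta)=\log\prod_{t=1}^n f(y_t,\theta)$, let $\widehat\theta_{S_m}\in\Theta_m$ be (almost surely, for every $n$) a maximum likelihood estimator over $\Theta_m$, that is, a maximiser of $\prod_{t=1}^n f(y_t,\theta_m)$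 over $\theta_{S_m}\in\Theta_m$, and let $\widehat\theta_m$ be its full version. Then $$n^{-1}l_n(\widehat\theta_m)=\mathrm E\{\log f(y,\theta^*_m)\}+o_p(1)\qquad(n\to\infty),$$ i.e. $n^{-1}l_n(\widehat\theta_m)$ converges in probability to $\mathrm E\{\log f(y,\theta^*_m)\}$. -/

import Mathlib

open MeasureTheory ProbabilityTheory Filter Topology

noncomputable section

namespace ModelAvg

/-- The full parameter space `ℝ^q`, `q = q₁ + q₂`: vectors `θ = (β, γ)` with `β ∈ ℝ^{q₁}` and
`γ ∈ ℝ^{q₂}`. -/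
abbrev Param (q₁ q₂ : ℕ) : Type := Fin q₁ ⊕ Fin q₂ → ℝ

/-- The parameter space `ℝ^{k}`, `k = q₁ + |S|`, of the sub-model that keeps all of `β` and the
coordinates `γ_j`, `j ∈ S`: vectors `θ_S = (β, γ_S)`. -/
abbrev SubParam (q₁ : ℕ) {q₂ : ℕ} (S : Finset (Fin q₂)) : Type := Fin q₁ ⊕ S → ℝ

/-- The full parameter `θ_m` belonging to `θ_S`: the coordinates `γ_j`, `j ∉ S`, are set to `0`. -/
def embed {q₁ q₂ : ℕ} (S : Finset (Fin q₂)) (θ : SubParam q₁ S) : Param q₁ q₂ :=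
  Sum.elim (fun i => θ (Sum.inl i)) (fun j => if h : j ∈ S then θ (Sum.inr ⟨j, h⟩) else 0)

/-- The parameters `θ_S` of the sub-model whose full version `θ_m` lies in `Θ`. -/
def slice {q₁ q₂ : ℕ} (S : Finset (Fin q₂)) (Θ : Set (Param q₁ q₂)) : Set (SubParam q₁ S) :=
  {θ | embed S θ ∈ Θ}

/-- The sub-model `S` is true for `θ₀`: `θ₀` is a parameter of that sub-model. -/
def IsTrueModel {q₁ q₂ : ℕ} (θ₀ : Param q₁ q₂) (S : Finset (Fin q₂)) : Prop :=
  ∃ θ : SubParam q₁ S, embed S θ = θ₀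

/-- The sub-model `S` contains all components of the true sub-model `So`. -/
def Overfitted {q₂ : ℕ} (So S : Finset (Fin q₂)) : Prop := So ⊆ S

/-- A sub-model is underfitted when it is not overfitted. -/
def Underfitted {q₂ : ℕ} (So S : Finset (Fin q₂)) : Prop := ¬ Overfitted So S

/-- The partial derivative `∂g/∂θ_i` at `θ`. -/
def pderiv {ι : Type*} [Fintype ι] [DecidableEq ι] (i : ι) (g : (ι → ℝ) → ℝ) (θ : ι → ℝ) : ℝ :=
  fderiv ℝ g θ (Pi.single i 1)

section Model

variable {𝓨 : Type*} [MeasurableSpace 𝓨] {q₁ q₂ : ℕ}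

/-- The distribution with density `f(·, θ)` with respect to `ν`. -/
def law (ν : Measure 𝓨) (f : 𝓨 → Param q₁ q₂ → ℝ) (θ : Param q₁ q₂) : Measure 𝓨 :=
  ν.withDensity (fun y => ENNReal.ofReal (f y θ))

/-- The likelihood `L_n(θ) = ∏_{t=1}^n f(y_t, θ)` of a sample path `y` (indexed from `0`). -/
def likelihood (f : 𝓨 → Param q₁ q₂ → ℝ) (y : ℕ → 𝓨) (n : ℕ) (θ : Param q₁ q₂) : ℝ :=
  ∏ t ∈ Finset.range n, f (y t) θ

/-- The log likelihood `l_n(θ) = log L_n(θ)`. -/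
def logLikelihood (f : 𝓨 → Param q₁ q₂ → ℝ) (y : ℕ → 𝓨) (n : ℕ) (θ : Param q₁ q₂) : ℝ :=
  Real.log (likelihood f y n θ)

/-- The Kullback-Leibler information `I{f(y, θ₀) : f(y, θ)} = E log {f(y, θ₀) / f(y, θ)}`, the
expectation being under `f(·, θ₀)`. -/
def klic (ν : Measure 𝓨) (f : 𝓨 → Param q₁ q₂ → ℝ) (θ₀ θ : Param q₁ q₂) : ℝ :=
  ∫ y, Real.log (f y θ₀ / f y θ) ∂(law ν f θ₀)

/-- The matrix `A_m(θ_S) = E {∂² log f(y, θ_m) / ∂θ_S ∂θ_Sᵀ}`. -/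
def hessianMean (ν : Measure 𝓨) (f : 𝓨 → Param q₁ q₂ → ℝ) (θ₀ : Param q₁ q₂)
    (S : Finset (Fin q₂)) (θ : SubParam q₁ S) : Matrix (Fin q₁ ⊕ S) (Fin q₁ ⊕ S) ℝ :=
  Matrix.of fun i j =>
    ∫ y, pderiv j (pderiv i fun η => Real.log (f y (embed S η))) θ ∂(law ν f θ₀)

/-- The matrix `B_m(θ_S) = E {(∂ log f(y, θ_m) / ∂θ_S) (∂ log f(y, θ_m) / ∂θ_S)ᵀ}`. -/
def scoreMean (ν : Measure 𝓨) (f : 𝓨 → Param q₁ q₂ → ℝ) (θ₀ : Param q₁ q₂)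
    (S : Finset (Fin q₂)) (θ : SubParam q₁ S) : Matrix (Fin q₁ ⊕ S) (Fin q₁ ⊕ S) ℝ :=
  Matrix.of fun i j =>
    ∫ y, pderiv i (fun η => Real.log (f y (embed S η))) θ *
      pderiv j (fun η => Real.log (f y (embed S η))) θ ∂(law ν f θ₀)

/-- The parametric family: `f(·, θ)`, `θ ∈ Θ`, are probability densities, measurable in `y` and
continuous in `θ` on the compact set `Θ`, and the true parameter `θ₀ ∈ Θ` is identifiable. -/
structure DensityFamily (ν : Measure 𝓨) (f : 𝓨 → Param q₁ q₂ → ℝ) (Θ : Set (Param q₁ q₂))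
    (θ₀ : Param q₁ q₂) : Prop where
  compact : IsCompact Θ
  mem : θ₀ ∈ Θ
  measurable : ∀ θ ∈ Θ, Measurable fun y => f y θ
  continuousOn : ∀ y, ContinuousOn (f y) Θ
  nonneg : ∀ θ ∈ Θ, ∀ y, 0 ≤ f y θ
  integral_eq_one : ∀ θ ∈ Θ, ∫ y, f y θ ∂ν = 1
  identifiable : ∀ θ ∈ Θ, (fun y => f y θ) =ᵐ[ν] (fun y => f y θ₀) → θ = θ₀

/-- `E log f(y, θ_m)` exists and `|log f(y, θ_m)| ≤ K(y)` for all `θ_m ∈ Θ` with `K` integrable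
under the true distribution. Since `log 0 = -∞` in this bound, it contains `f(y, θ_m) > 0`.
The last field says that the Kullback-Leibler information is well defined. -/
structure LogDominated (ν : Measure 𝓨) (f : 𝓨 → Param q₁ q₂ → ℝ) (Θ : Set (Param q₁ q₂))
    (θ₀ : Param q₁ q₂) (S : Finset (Fin q₂)) : Prop where
  integrable_log : ∀ θ ∈ slice S Θ, Integrable (fun y => Real.log (f y (embed S θ))) (law ν f θ₀)
  pos : ∀ θ ∈ slice S Θ, ∀ y, 0 < f y (embed S θ)
  dominated : ∃ K : 𝓨 → ℝ, Integrable K (law ν f θ₀) ∧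
    ∀ θ ∈ slice S Θ, ∀ y, |Real.log (f y (embed S θ))| ≤ K y
  integrable_klic : ∀ θ ∈ slice S Θ,
    Integrable (fun y => Real.log (f y θ₀ / f y (embed S θ))) (law ν f θ₀)

/-- `θs` is the unique minimiser of the Kullback-Leibler information over `Θm`. -/
def IsKLMinimiser (ν : Measure 𝓨) (f : 𝓨 → Param q₁ q₂ → ℝ) (θ₀ : Param q₁ q₂)
    (S : Finset (Fin q₂)) (Θm : Set (SubParam q₁ S)) (θs : SubParam q₁ S) : Prop :=
  θs ∈ Θm ∧ ∀ θ ∈ Θm, θ ≠ θs → klic ν f θ₀ (embed S θs) < klic ν f θ₀ (embed S θ)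

/-- The second partial derivatives of `f(y, θ_m)` in `θ_S` exist and are continuous for all `y`,
and may be passed under the integral sign in `∫ f(y, θ_m) dν(y)`. -/
structure SmoothDensity (ν : Measure 𝓨) (f : 𝓨 → Param q₁ q₂ → ℝ) (Θ : Set (Param q₁ q₂))
    (S : Finset (Fin q₂)) : Prop where
  contDiffOn : ∀ y, ContDiffOn ℝ 2 (fun θ => f y (embed S θ)) (interior (slice S Θ))
  integrable_second : ∀ θ ∈ interior (slice S Θ), ∀ i j,
    Integrable (fun y => pderiv j (pderiv i fun η => f y (embed S η)) θ) ν
  second_under_integral : ∀ θ ∈ interior (slice S Θ), ∀ i j,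
    pderiv j (pderiv i fun η => ∫ y, f y (embed S η) ∂ν) θ =
      ∫ y, pderiv j (pderiv i fun η => f y (embed S η)) θ ∂ν

/-- The second partial derivatives of `log f(y, θ_m)` and the products of its first partial
derivatives are dominated, uniformly in `θ_m`, by functions integrable under the true
distribution. -/
structure DerivDominated (ν : Measure 𝓨) (f : 𝓨 → Param q₁ q₂ → ℝ) (Θ : Set (Param q₁ q₂))
    (θ₀ : Param q₁ q₂) (S : Finset (Fin q₂)) : Prop where
  second : ∀ i j, ∃ H : 𝓨 → ℝ, Integrable H (law ν f θ₀) ∧ ∀ θ ∈ interior (slice S Θ), ∀ y,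
    |pderiv j (pderiv i fun η => Real.log (f y (embed S η))) θ| ≤ H y
  first_mul_first : ∀ i j, ∃ H : 𝓨 → ℝ, Integrable H (law ν f θ₀) ∧
    ∀ θ ∈ interior (slice S Θ), ∀ y,
      |pderiv i (fun η => Real.log (f y (embed S η))) θ *
        pderiv j (fun η => Real.log (f y (embed S η))) θ| ≤ H y

/-- `θs` is interior to `Θm`, the matrix `B_m(θs)` is nonsingular, and `θs` is a regular point of
`A_m`, which has constant rank in an open neighbourhood of `θs`. -/
structure RegularMinimiser (ν : Measure 𝓨) (f : 𝓨 → Param q₁ q₂ → ℝ) (θ₀ : Param q₁ q₂)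
    (S : Finset (Fin q₂)) (Θm : Set (SubParam q₁ S)) (θs : SubParam q₁ S) : Prop where
  mem_interior : θs ∈ interior Θm
  nonsingular : (scoreMean ν f θ₀ S θs).det ≠ 0
  constant_rank : ∃ U : Set (SubParam q₁ S), IsOpen U ∧ θs ∈ U ∧
    ∀ θ ∈ U, (hessianMean ν f θ₀ S θ).rank = (hessianMean ν f θ₀ S θs).rank

/-- `θhat n` is, almost surely, a maximum likelihood estimator over `Θm` based on the first `n`
observations of `y`. -/
def IsMLE {Ω : Type*} [MeasurableSpace Ω] (P : Measure Ω) (f : 𝓨 → Param q₁ q₂ → ℝ)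
    (y : ℕ → Ω → 𝓨) (S : Finset (Fin q₂)) (Θm : Set (SubParam q₁ S))
    (θhat : ℕ → Ω → SubParam q₁ S) : Prop :=
  ∀ n, ∀ᵐ ω ∂P, θhat n ω ∈ Θm ∧
    IsMaxOn (fun θ => likelihood f (fun t => y t ω) n (embed S θ)) Θm (θhat n ω)

end Model

end ModelAvg

end

open MeasureTheory ProbabilityTheory Filter Topology

/-! Only the maximal value matters, so convergence of `θhat` is not needed. The maps `θ ↦ log f(u,
θ_m)` are random elements of the Banach space of continuous functions on the compact set `slice S
Θ`. The Banach-valued strong law makes their averages converge in sup norm to the mean function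
(`tendstoInMeasure_average_continuousMap`). The MLE maximises the average over `Θm`, and the KL
minimiser maximises its limit there (`IsKLMinimiser.isMaxOn`). Maxima of uniformly close functions
are close (`IsMaxOn.abs_sub_le`), so the error is at most the sup-norm distance. -/

namespace ContinuousMap

variable {α K : Type*} [MeasurableSpace α] [MetricSpace K] [CompactSpace K]

/-- The distance of a pointwise measurable family of continuous functions on a compact metric space
to a fixed function is measurable. -/
theorem measurable_dist_of_eval {F : α → C(K, ℝ)} (hF : ∀ x, Measurable fun a => F a x)
    (g : C(K, ℝ)) : Measurable fun a => dist (F a) g := by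
  refine measurable_of_Iic fun r => ?_
  rcases lt_or_ge r 0 with hr | hr
  · convert! MeasurableSet.empty
    ext a
    simpa using hr.trans_le dist_nonneg
  -- By continuity, a closed pointwise bound holds on all of `K` once it holds on a countable dense
  -- set.
  · obtain ⟨D, hDc, hD⟩ := TopologicalSpace.exists_countable_dense K
    have hset : (fun a => dist (F a) g) ⁻¹' Set.Iic r = ⋂ x ∈ D, {a | dist (F a x) (g x) ≤ r} := by
      ext a
      simp only [Set.mem_preimage, Set.mem_Iic, Set.mem_iInter, Set.mem_ofPred_eq,
        ContinuousMap.dist_le hr]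
      refine ⟨fun h x _ => h x, fun h x => ?_⟩
      have hcl : IsClosed {x | dist (F a x) (g x) ≤ r} :=
        isClosed_le ((F a).continuous.dist g.continuous) continuous_const
      exact hcl.closure_subset_iff.2 h (hD x)
    rw [hset]
    exact MeasurableSet.biInter hDc fun x _ =>
      measurableSet_le ((hF x).dist measurable_const) measurable_const

/-- On a compact metric space, a family of continuous functions that is pointwise measurable is
Borel measurable for the uniform norm. -/
theorem measurable_of_eval [MeasurableSpace C(K, ℝ)] [BorelSpace C(K, ℝ)] {F : α → C(K, ℝ)}
    (hF : ∀ x, Measurable fun a => F a x) : Measurable F := by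
  refine measurable_of_isOpen fun O hO => ?_
  choose! r hr hrO using Metric.isOpen_iff.1 hO
  -- The function space over a compact metric space is second countable, so countably many of these
  -- balls cover `O`; each ball has measurable preimage.
  obtain ⟨T, hTc, hT⟩ := TopologicalSpace.isOpen_iUnion_countable
    (fun g : O => Metric.ball (g : C(K, ℝ)) (r g)) fun _ => Metric.isOpen_ball
  have hOT : O = ⋃ g ∈ T, Metric.ball (g : C(K, ℝ)) (r g) := by
    rw [hT]
    refine Set.Subset.antisymm (fun g hg => ?_) (Set.iUnion_subset fun g => hrO g g.2)
    exact Set.mem_iUnion.2 ⟨⟨g, hg⟩, Metric.mem_ball_self (hr g hg)⟩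
  rw [hOT, Set.preimage_iUnion₂]
  exact MeasurableSet.biUnion hTc fun g _ =>
    measurableSet_lt (measurable_dist_of_eval hF g) measurable_const

end ContinuousMap

namespace ProbabilityTheory

variable {𝓨 Ω K : Type*} [MeasurableSpace 𝓨] [MeasurableSpace Ω] {P : Measure Ω}
  [IsProbabilityMeasure P] {μ : Measure 𝓨} [MetricSpace K] [CompactSpace K]

/-- **Uniform law of large numbers** over a compact metric space: the empirical mean of a dominated
family of continuous functions converges in probability, uniformly over the space. -/
theorem tendstoInMeasure_average_continuousMap [Nonempty K] {y : ℕ → Ω → 𝓨}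
    (hy : ∀ t, Measurable (y t)) (hindep : iIndepFun y P) (hlaw : ∀ t, P.map (y t) = μ)
    {F : 𝓨 → C(K, ℝ)} (hF : ∀ x, Measurable fun u => F u x) {G : 𝓨 → ℝ} (hG : Integrable G μ)
    (hFG : ∀ u x, |F u x| ≤ G u) :
    Integrable F μ ∧
      TendstoInMeasure P (fun (n : ℕ) ω => (n : ℝ)⁻¹ • ∑ t ∈ Finset.range n, F (y t ω)) atTop
        fun _ => ∫ u, F u ∂μ := by
  borelize C(K, ℝ)
  have hFm : Measurable F := ContinuousMap.measurable_of_eval hF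
  have hint : Integrable F μ := hG.mono' hFm.aestronglyMeasurable
    (ae_of_all _ fun u => (ContinuousMap.norm_le_of_nonempty _).2 (hFG u))
  refine ⟨hint, tendstoInMeasure_of_tendsto_ae (fun n => ?_) ?_⟩
  · exact ((Finset.measurable_fun_sum _ fun t _ => hFm.comp (hy t)).const_smul
      ((n : ℝ)⁻¹)).aestronglyMeasurable
  · have hmean : ∫ u, F u ∂μ = ∫ ω, F (y 0 ω) ∂P := by
      rw [← hlaw 0, integral_map (hy 0).aemeasurable hFm.aestronglyMeasurable]
    rw [hmean]
    -- Norm convergence in `C(K, ℝ)` is uniform convergence, so no covering argument is needed.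
    refine strong_law_ae (fun t => F ∘ y t) ?_ (fun s t hst => ?_) fun t => ?_
    · rw [← hlaw 0] at hint
      exact hint.comp_measurable (hy 0)
    · exact (hindep.indepFun hst).comp hFm hFm
    · exact IdentDistrib.comp
        ⟨(hy t).aemeasurable, (hy 0).aemeasurable, (hlaw t).trans (hlaw 0).symm⟩ hFm

end ProbabilityTheory

namespace MeasureTheory

/-- Domination by an almost everywhere bound: no measurability of the dominated sequence is
needed. -/
theorem TendstoInMeasure.of_ae_dist_le {Ω ι E E' : Type*} [MeasurableSpace Ω] {P : Measure Ω}
    [PseudoMetricSpace E] [PseudoMetricSpace E'] {l : Filter ι} {f : ι → Ω → E} {g : Ω → E}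
    {f' : ι → Ω → E'} {g' : Ω → E'} (h : TendstoInMeasure P f l g)
    (hle : ∀ n, ∀ᵐ ω ∂P, dist (f' n ω) (g' ω) ≤ dist (f n ω) (g ω)) :
    TendstoInMeasure P f' l g' := by
  rw [tendstoInMeasure_iff_dist] at h ⊢
  intro ε hε
  refine tendsto_of_tendsto_of_tendsto_of_le_of_le tendsto_const_nhds (h ε hε)
    (fun _ => zero_le) fun n => measure_mono_ae ?_
  filter_upwards [hle n] with ω hω using fun hε' => le_trans hε' hω

end MeasureTheory

/-- If `a` maximises `A` over `s`, `b` maximises `B` over `s` and `A`, `B` are uniformly `δ`-close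
on `s`, then the maxima are `δ`-close. -/
theorem IsMaxOn.abs_sub_le {α : Type*} {s : Set α} {A B : α → ℝ} {a b : α} {δ : ℝ}
    (hA : IsMaxOn A s a) (hB : IsMaxOn B s b) (ha : a ∈ s) (hb : b ∈ s)
    (h : ∀ x ∈ s, |A x - B x| ≤ δ) : |A a - B b| ≤ δ := by
  have h1 := abs_le.1 (h a ha)
  have h2 := abs_le.1 (h b hb)
  have h3 : A b ≤ A a := hA hb
  have h4 : B a ≤ B b := hB ha
  exact abs_le.2 ⟨by linarith, by linarith⟩

namespace ModelAvg

variable {𝓨 : Type*} [MeasurableSpace 𝓨] {q₁ q₂ : ℕ}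

theorem embed_apply_inl (S : Finset (Fin q₂)) (θ : SubParam q₁ S) (i : Fin q₁) :
    embed S θ (Sum.inl i) = θ (Sum.inl i) := rfl

theorem embed_apply_inr (S : Finset (Fin q₂)) (θ : SubParam q₁ S) (j : S) :
    embed S θ (Sum.inr j) = θ (Sum.inr j) := by
  simp [embed]

/-- Closedness is what passes compactness from `Θ` to `slice S Θ`. It holds because forgetting the
coordinates outside `S` is a continuous left inverse. -/
theorem isClosedEmbedding_embed (S : Finset (Fin q₂)) :
    IsClosedEmbedding (embed S : SubParam q₁ S → Param q₁ q₂) := by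
  have hcont : Continuous (embed S : SubParam q₁ S → Param q₁ q₂) := by
    refine continuous_pi fun k => ?_
    rcases k with i | j
    · exact continuous_apply (Sum.inl i)
    · by_cases h : j ∈ S
      · simpa [embed, h] using continuous_apply (Sum.inr (⟨j, h⟩ : S) : Fin q₁ ⊕ S)
      · simpa [embed, h] using continuous_const
  let restr : Param q₁ q₂ → SubParam q₁ S := fun θ => Sum.elim (fun i => θ (Sum.inl i))
    fun j => θ (Sum.inr j)
  have hrestr : Continuous restr := by
    refine continuous_pi fun k => ?_
    rcases k with i | j
    · exact continuous_apply (Sum.inl i)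
    · exact continuous_apply (Sum.inr (j : Fin q₂))
  have hleft : Function.LeftInverse restr (embed S) := by
    intro θ
    funext k
    rcases k with i | j
    · exact embed_apply_inl S θ i
    · exact embed_apply_inr S θ j
  exact hleft.isClosedEmbedding hrestr hcont

theorem isCompact_slice (S : Finset (Fin q₂)) {Θ : Set (Param q₁ q₂)} (hΘ : IsCompact Θ) :
    IsCompact (slice S Θ) :=
  (isClosedEmbedding_embed S).isCompact_preimage hΘ

/-- The density is positive almost everywhere under its own law. -/
theorem ae_law_pos (ν : Measure 𝓨) {f : 𝓨 → Param q₁ q₂ → ℝ} {θ : Param q₁ q₂}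
    (hf : Measurable fun y => f y θ) : ∀ᵐ y ∂law ν f θ, 0 < f y θ := by
  rw [law, ae_withDensity_iff hf.ennreal_ofReal]
  exact ae_of_all _ fun y hy => by simpa using hy

/-- The Kullback-Leibler information and the expected log density differ by a constant. -/
theorem klic_sub_klic {ν : Measure 𝓨} {f : 𝓨 → Param q₁ q₂ → ℝ} {Θ : Set (Param q₁ q₂)}
    {θ₀ : Param q₁ q₂} {S : Finset (Fin q₂)} (hf : Measurable fun y => f y θ₀)
    (hlog : LogDominated ν f Θ θ₀ S) {θ η : SubParam q₁ S} (hθ : θ ∈ slice S Θ)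
    (hη : η ∈ slice S Θ) :
    klic ν f θ₀ (embed S θ) - klic ν f θ₀ (embed S η) =
      (∫ y, Real.log (f y (embed S η)) ∂law ν f θ₀) -
        ∫ y, Real.log (f y (embed S θ)) ∂law ν f θ₀ := by
  rw [klic, klic, ← integral_sub (hlog.integrable_klic θ hθ) (hlog.integrable_klic η hη),
    ← integral_sub (hlog.integrable_log η hη) (hlog.integrable_log θ hθ)]
  refine integral_congr_ae ?_
  -- The density at `θ₀` may vanish, so the logarithm of the ratio splits only almost everywhere
  -- under the true law.
  filter_upwards [ae_law_pos ν hf] with y hy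
  rw [Real.log_div hy.ne' (hlog.pos θ hθ y).ne', Real.log_div hy.ne' (hlog.pos η hη y).ne']
  ring

/-- A minimiser of the Kullback-Leibler information maximises the expected log density. -/
theorem IsKLMinimiser.isMaxOn {ν : Measure 𝓨} {f : 𝓨 → Param q₁ q₂ → ℝ} {Θ : Set (Param q₁ q₂)}
    {θ₀ : Param q₁ q₂} {S : Finset (Fin q₂)} {Θm : Set (SubParam q₁ S)} {θs : SubParam q₁ S}
    (hmin : IsKLMinimiser ν f θ₀ S Θm θs) (hf : Measurable fun y => f y θ₀)
    (hlog : LogDominated ν f Θ θ₀ S) (hΘm : Θm ⊆ slice S Θ) :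
    IsMaxOn (fun θ => ∫ y, Real.log (f y (embed S θ)) ∂law ν f θ₀) Θm θs := by
  intro θ hθ
  rcases eq_or_ne θ θs with rfl | hne
  · exact le_refl (∫ y, Real.log (f y (embed S θ)) ∂law ν f θ₀)
  · have h1 := hmin.2 θ hθ hne
    have h2 := klic_sub_klic hf hlog (hΘm hθ) (hΘm hmin.1)
    show (∫ y, Real.log (f y (embed S θ)) ∂law ν f θ₀) ≤ _
    linarith

theorem logLikelihood_eq_sum {𝓨 : Type*} {f : 𝓨 → Param q₁ q₂ → ℝ} {y : ℕ → 𝓨} {n : ℕ} {θ : Param q₁ q₂}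
    (h : ∀ u, 0 < f u θ) :
    logLikelihood f y n θ = ∑ t ∈ Finset.range n, Real.log (f (y t) θ) :=
  Real.log_prod fun t _ => (h (y t)).ne'

end ModelAvg

theorem lemma2 {𝓨 : Type*} [MeasurableSpace 𝓨] (ν : Measure 𝓨) [SigmaFinite ν]
    {Ω : Type*} [MeasurableSpace Ω] (P : Measure Ω) [IsProbabilityMeasure P]
    {q₁ q₂ M : ℕ} (f : 𝓨 → ModelAvg.Param q₁ q₂ → ℝ)
    (Θ : Set (ModelAvg.Param q₁ q₂)) (θ₀ : ModelAvg.Param q₁ q₂)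
    (y : ℕ → Ω → 𝓨) (hy_meas : ∀ t, Measurable (y t)) (hy_indep : iIndepFun y P)
    (hy_law : ∀ t, P.map (y t) = ModelAvg.law ν f θ₀)
    (S : Fin M → Finset (Fin q₂)) (mo m : Fin M)
    (hmo : ModelAvg.IsTrueModel θ₀ (S mo)) (hm : ModelAvg.Underfitted (S mo) (S m))
    (Θm : Set (ModelAvg.SubParam q₁ (S m))) (hΘm : Θm ⊆ ModelAvg.slice (S m) Θ)
    (θs : ModelAvg.SubParam q₁ (S m))
    (hdens : ModelAvg.DensityFamily ν f Θ θ₀)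
    (hlog : ModelAvg.LogDominated ν f Θ θ₀ (S m))
    (hmin : ModelAvg.IsKLMinimiser ν f θ₀ (S m) Θm θs)
    (hsmooth : ModelAvg.SmoothDensity ν f Θ (S m))
    (hderiv : ModelAvg.DerivDominated ν f Θ θ₀ (S m))
    (hreg : ModelAvg.RegularMinimiser ν f θ₀ (S m) Θm θs)
    (θhat : ℕ → Ω → ModelAvg.SubParam q₁ (S m))
    (hmle : ModelAvg.IsMLE P f y (S m) Θm θhat) :
    TendstoInMeasure P
      (fun (n : ℕ) (ω : Ω) =>
        (n : ℝ)⁻¹ * ModelAvg.logLikelihood f (fun t => y t ω) n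
          (ModelAvg.embed (S m) (θhat n ω)))
      atTop
      (fun _ => ∫ u, Real.log (f u (ModelAvg.embed (S m) θs)) ∂(ModelAvg.law ν f θ₀)) := by
  have hpos := hlog.pos
  obtain ⟨G, hG, hfG⟩ := hlog.dominated
  -- The uniform law is applied on the whole slice because `Θm` need not be compact.
  have hcomp : CompactSpace (ModelAvg.slice (S m) Θ) :=
    isCompact_iff_compactSpace.1 (ModelAvg.isCompact_slice (S m) hdens.compact)
  have hne : Nonempty (ModelAvg.slice (S m) Θ) := ⟨⟨θs, hΘm hmin.1⟩⟩
  let F : 𝓨 → C(ModelAvg.slice (S m) Θ, ℝ) := fun u =>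
    ⟨fun θ => Real.log (f u (ModelAvg.embed (S m) θ)),
      (((hdens.continuousOn u).comp_continuous
        ((ModelAvg.isClosedEmbedding_embed (S m)).continuous.comp continuous_subtype_val)
        fun θ => θ.2).log fun θ => (hpos θ θ.2 u).ne')⟩
  obtain ⟨hFint, hlim⟩ := tendstoInMeasure_average_continuousMap hy_meas hy_indep hy_law
    (F := F) (fun θ => (hdens.measurable _ θ.2).log) hG fun u θ => hfG θ θ.2 u
  refine hlim.of_ae_dist_le fun n => ?_
  filter_upwards [hmle n] with ω ⟨hmem, hmax⟩
  -- Evaluation at a point is continuous and linear, so it commutes with the Bochner integral.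
  have hmean : ∀ θ : ModelAvg.slice (S m) Θ, (∫ u, F u ∂ModelAvg.law ν f θ₀) θ =
      ∫ u, Real.log (f u (ModelAvg.embed (S m) θ)) ∂ModelAvg.law ν f θ₀ := fun θ =>
    ((ContinuousMap.evalCLM ℝ θ).integral_comp_comm hFint).symm
  refine IsMaxOn.abs_sub_le (s := Θm)
    (A := fun θ => (n : ℝ)⁻¹ * ModelAvg.logLikelihood f (fun t => y t ω) n
      (ModelAvg.embed (S m) θ))
    (fun θ hθ => ?_) (hmin.isMaxOn (hdens.measurable θ₀ hdens.mem) hlog hΘm) hmem hmin.1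
    fun θ hθ => ?_
  -- Positivity of the likelihood lets the logarithm preserve its maximiser.
  · exact mul_le_mul_of_nonneg_left
      (Real.log_le_log (Finset.prod_pos fun t _ => hpos θ (hΘm hθ) _) (hmax hθ)) (by positivity)
  · have h := ContinuousMap.dist_apply_le_dist
      (f := (n : ℝ)⁻¹ • ∑ t ∈ Finset.range n, F (y t ω)) (g := ∫ u, F u ∂ModelAvg.law ν f θ₀)
      ⟨θ, hΘm hθ⟩
    rw [hmean, Real.dist_eq] at h
    rw [ModelAvg.logLikelihood_eq_sum (hpos θ (hΘm hθ))]
    simpa [F, ContinuousMap.sum_apply] using h
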